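/- For integers $n,m\ge 1$ let $G_{n,m}=C_n\times P_m$ be the cylinder graph: the simple graph with vertex set $\{(i,j): i\in\mathbb{Z}_n,\ 0\le j\le m-1\}$, with ring edges $\{(i,j),(i+1,j)\}$ ($i\in\mathbb Z_n$, for $n\ge 2$) and path edges $\{(i,j),(i,j+1)\}$ ($0\le j\le m-2$). The $k$-th ring is $R_k=\{(i,k): i\in\mathbb{Z}_n\}$. A *trunk* of a spanning tree $T$ of $G_{n,m}$ is a simple path $L$ in $T$ (possibly a single vertex) that meets every ring $R_0,\dots,R_{m-1}$. A *branch* off a trunk $L$ of $T$ is a simple path in $T$ with two distinct endpoints, one of which lies on $L$, that has no other vertex on $L$, and that is maximal by inclusion among such paths; its length is its number of edges. **Theorem.** For every integer $n\ge 1$ there exist constants $C>0$ and $\theta\in(0,1)$, depending only on $n$, such that for every integer $m\ge 1$ one can assign to each spanning tree $T$ of $G_{n,m}$ a trunk $L(T)$ of $T$ with the following property: if $T$ is chosen uniformly at random among all spanning trees of $G_{n,m}$, then for every integer $l\ge 0$, $$\mathbb{P}\bigl(T\text{ has a branch off }L(T)\text{ of length}\ge l\bigr)\ \le\ C\,m\,(n-1)\,\theta^{\,l}.$$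 -/

import Mathlib

/-- The cylinder graph `C_n × P_m`, with vertex set `Fin n × Fin m`: Cartesian product of the cycle
on `Fin n` and the path on `Fin m`. -/
def cylinder (n m : ℕ) : SimpleGraph (Fin n × Fin m) :=
  (SimpleGraph.cycleGraph n).boxProd (SimpleGraph.pathGraph m)

/-- The cylinder is connected as soon as it has a vertex. -/
theorem cylinder_connected {n m : ℕ} (hn : 1 ≤ n) (hm : 1 ≤ m) : (cylinder n m).Connected := by
  obtain ⟨a, rfl⟩ := Nat.exists_eq_add_of_le' hn
  obtain ⟨b, rfl⟩ := Nat.exists_eq_add_of_le' hm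
  exact (SimpleGraph.cycleGraph_connected).boxProd (SimpleGraph.pathGraph_connected b)

/-- The `k`-th ring of the cylinder. -/
def cylinderRing (n : ℕ) {m : ℕ} (k : Fin m) : Set (Fin n × Fin m) := {v | v.2 = k}

/-- The spanning trees of a graph `G`: the trees on the same vertex set whose edges are
edges of `G`. -/
def SpanningTree {V : Type*} (G : SimpleGraph V) : Type _ :=
  {T : SimpleGraph V // T ≤ G ∧ T.IsTree}

/-- A finite graph has finitely many spanning trees. -/
noncomputable instance spanningTreeFintype {V : Type*} [Finite V] (G : SimpleGraph V) : Fintype (SpanningTree G) :=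
  haveI : Finite (SpanningTree G) := Subtype.finite
  Fintype.ofFinite _

/-- The law of the uniform spanning tree of a finite connected graph. -/
noncomputable def uniformSpanningTree {V : Type*} [Finite V] (G : SimpleGraph V)
    (hG : G.Connected) : PMF (SpanningTree G) :=
  haveI : Nonempty (SpanningTree G) :=
    let ⟨T, hT⟩ := hG.exists_isTree_le
    ⟨⟨T, hT⟩⟩
  PMF.uniformOfFintype (SpanningTree G)

/-- A trunk of a spanning tree `T` of the cylinder: a simple path in `T` that meets every ring. -/
structure Trunk {n m : ℕ} (T : SpanningTree (cylinder n m)) where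
  /-- The first vertex. -/
  first : Fin n × Fin m
  /-- The last vertex. -/
  last : Fin n × Fin m
  /-- The path, as a walk in `T`. -/
  walk : T.1.Walk first last
  isPath : walk.IsPath
  meets_ring : ∀ k : Fin m, ∃ v ∈ walk.support, v ∈ cylinderRing n k

/-- The set of vertices of a trunk. -/
def Trunk.vertices {n m : ℕ} {T : SpanningTree (cylinder n m)} (L : Trunk T) :
    Set (Fin n × Fin m) := {v | v ∈ L.walk.support}

/-- `p` is a simple path in `T`, with two distinct endpoints, which has its starting point in `S`
and no other vertex in `S`. -/
structure IsPathOff {V : Type*} {T : SimpleGraph V} (S : Set V) {u v : V} (p : T.Walk u v) :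
    Prop where
  isPath : p.IsPath
  ne : u ≠ v
  mem_iff : ∀ x ∈ p.support, x ∈ S ↔ x = u

/-- `p` is a branch off `S` in `T`: it is maximal by inclusion (of vertices and edges) among the
simple paths that have one endpoint and no other vertex in `S`. -/
def IsBranch {V : Type*} {T : SimpleGraph V} (S : Set V) {u v : V} (p : T.Walk u v) : Prop :=
  IsPathOff S p ∧ ∀ (u' v' : V) (q : T.Walk u' v'),
    IsPathOff S q → p.toSubgraph ≤ q.toSubgraph → q.toSubgraph ≤ p.toSubgraph

/-- The tree `T` has a branch off the trunk `L` with at least `l` edges. -/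
def HasBranchOfLengthGE {n m : ℕ} {T : SpanningTree (cylinder n m)} (L : Trunk T) (l : ℕ) : Prop :=
  ∃ (u v : Fin n × Fin m) (p : T.1.Walk u v), IsBranch L.vertices p ∧ l ≤ p.length

open SimpleGraph

/-! Any choice of trunk works. A branch of length `l`, without its vertex on the trunk, has `l`
vertices, hence spans at least `l / n` rings; with the trunk it gives two disjoint crossings of
these rings (`HasBranchOfLengthGE.exists_twoCrossings`). Such double crossings are exponentially
rare: rewiring a tree on rings `k` and `k + 1` so that one edge joins them destroys a double
crossing up to ring `k + 1` but keeps it up to ring `k` (`exists_switch`). This map is at most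
`blockCount n`-to-one, a bound independent of `m`, so each further ring costs a fixed factor below
1. A union bound over the starting ring gives the factor `m`. -/

theorem cylinder_adj {n m : ℕ} {x y : Fin n × Fin m} :
    (cylinder n m).Adj x y ↔ (cycleGraph n).Adj x.1 y.1 ∧ x.2 = y.2 ∨
      ((x.2 : ℕ) + 1 = y.2 ∨ (y.2 : ℕ) + 1 = x.2) ∧ x.1 = y.1 := by
  rw [cylinder, boxProd_adj, pathGraph_adj]

theorem cylinder_adj_snd_le {n m : ℕ} {x y : Fin n × Fin m} (h : (cylinder n m).Adj x y) :
    (y.2 : ℕ) ≤ x.2 + 1 := by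
  rcases cylinder_adj.1 h with ⟨-, h⟩ | ⟨h, -⟩
  · rw [h]; omega
  · omega

/-- The graph `T` has a walk inside `S` from the `a`-th ring to the `b`-th ring. -/
def Crosses {n m : ℕ} (T : SimpleGraph (Fin n × Fin m)) (a b : ℕ) (S : Set (Fin n × Fin m)) :
    Prop :=
  ∃ (u v : Fin n × Fin m) (p : T.Walk u v), (u.2 : ℕ) = a ∧ (v.2 : ℕ) = b ∧ ∀ x ∈ p.support, x ∈ S

/-- The graph `T` has two disjoint walks from the `a`-th ring to the `b`-th ring. -/
def TwoCrossings {n m : ℕ} (T : SimpleGraph (Fin n × Fin m)) (a b : ℕ) : Prop :=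
  ∃ S, Crosses T a b S ∧ Crosses T a b Sᶜ

/-! ### Walks and crossings between rings -/

section Walks

variable {n m : ℕ} {T : SimpleGraph (Fin n × Fin m)}

/-- A walk can be stopped at the first time at which it reaches the `k`-th ring. -/
theorem exists_walk_below (hT : T ≤ cylinder n m) {u v : Fin n × Fin m} (p : T.Walk u v) {k : ℕ}
    (hu : (u.2 : ℕ) ≤ k) (hv : k ≤ v.2) :
    ∃ (w : Fin n × Fin m) (q : T.Walk u w), (w.2 : ℕ) = k ∧
      ∀ x ∈ q.support, x ∈ p.support ∧ (x.2 : ℕ) ≤ k := by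
  induction p with
  | nil => exact ⟨_, .nil, le_antisymm hu hv, by simpa using hu⟩
  | @cons u x v h p ih =>
    rcases hu.eq_or_lt with hu' | hu'
    · exact ⟨u, .nil, hu', by simpa using hu⟩
    · obtain ⟨w, q, hw, hq⟩ := ih (by have := cylinder_adj_snd_le (hT h); omega) hv
      refine ⟨w, .cons h q, hw, fun y hy ↦ ?_⟩
      rw [Walk.support_cons, List.mem_cons] at hy ⊢
      rcases hy with rfl | hy
      · exact ⟨.inl rfl, hu⟩
      · exact ⟨.inr (hq y hy).1, (hq y hy).2⟩

theorem exists_vertical_edge (hT : T ≤ cylinder n m) {u v : Fin n × Fin m} (p : T.Walk u v) {k : ℕ}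
    (hu : (u.2 : ℕ) ≤ k) (hv : k + 1 ≤ v.2) :
    ∃ x ∈ p.support, ∃ y, T.Adj x y ∧ (x.2 : ℕ) = k ∧ (y.2 : ℕ) = k + 1 := by
  induction p with
  | nil => omega
  | @cons u x v h p ih =>
    by_cases hx : (x.2 : ℕ) ≤ k
    · obtain ⟨y, hy, hy'⟩ := ih hx hv
      exact ⟨y, by simp [hy], hy'⟩
    · have := cylinder_adj_snd_le (hT h)
      exact ⟨u, by simp, x, h, by omega, by omega⟩

theorem exists_walk_between {V : Type*} {G : SimpleGraph V} {u v x y : V} (p : G.Walk u v)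
    (hx : x ∈ p.support) (hy : y ∈ p.support) :
    ∃ q : G.Walk x y, ∀ z ∈ q.support, z ∈ p.support := by
  classical
  refine ⟨(p.takeUntil x hx).reverse.append (p.takeUntil y hy), fun z hz ↦ ?_⟩
  rw [Walk.mem_support_append_iff, Walk.support_reverse, List.mem_reverse] at hz
  rcases hz with hz | hz
  · exact p.support_takeUntil_subset_support hx hz
  · exact p.support_takeUntil_subset_support hy hz

theorem Crosses.mono_right (hT : T ≤ cylinder n m) {a b c : ℕ} {S : Set (Fin n × Fin m)}
    (h : Crosses T a c S) (hab : a ≤ b) (hbc : b ≤ c) : Crosses T a b S := by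
  obtain ⟨u, v, p, hu, hv, hp⟩ := h
  obtain ⟨w, q, hw, hq⟩ := exists_walk_below hT p (k := b) (by omega) (by omega)
  exact ⟨u, w, q, hu, hw, fun x hx ↦ hp x (hq x hx).1⟩

theorem TwoCrossings.mono_right (hT : T ≤ cylinder n m) {a b c : ℕ}
    (h : TwoCrossings T a c) (hab : a ≤ b) (hbc : b ≤ c) : TwoCrossings T a b := by
  obtain ⟨S, h₁, h₂⟩ := h
  exact ⟨S, h₁.mono_right hT hab hbc, h₂.mono_right hT hab hbc⟩

theorem Crosses.of_adj_below (hT : T ≤ cylinder n m) {T' : SimpleGraph (Fin n × Fin m)} {a k : ℕ}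
    (hTT' : ∀ x y, T.Adj x y → (x.2 : ℕ) ≤ k → (y.2 : ℕ) ≤ k → T'.Adj x y)
    {S : Set (Fin n × Fin m)} (h : Crosses T a k S) (hak : a ≤ k) : Crosses T' a k S := by
  obtain ⟨u, v, p, hu, hv, hp⟩ := h
  obtain ⟨w, q, hw, hq⟩ := exists_walk_below hT p (k := k) (by omega) (by omega)
  have hqT' : ∀ e ∈ q.edges, e ∈ T'.edgeSet := by
    intro e he
    induction e with
    | h x y =>
      exact hTT' x y (q.adj_of_mem_edges he) (hq x (q.fst_mem_support_of_mem_edges he)).2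
        (hq y (q.snd_mem_support_of_mem_edges he)).2
  refine ⟨u, w, q.transfer T' hqT', hu, hw, fun x hx ↦ hp x (hq x ?_).1⟩
  rwa [Walk.support_transfer] at hx

/-- Both crossings would have to contain the vertex of ring `k` in column `i`. -/
theorem not_twoCrossings_of_unique_edge (hT : T ≤ cylinder n m) {a k : ℕ} (hak : a ≤ k) (i : Fin n)
    (h : ∀ x y, T.Adj x y → (x.2 : ℕ) = k → (y.2 : ℕ) = k + 1 → x.1 = i) :
    ¬ TwoCrossings T a (k + 1) := by
  rintro ⟨S, ⟨u, v, p, hu, hv, hp⟩, ⟨u', v', p', hu', hv', hp'⟩⟩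
  obtain ⟨x, hx, y, hxy, hxk, hyk⟩ := exists_vertical_edge hT p (k := k) (by omega) (by omega)
  obtain ⟨x', hx', y', hxy', hxk', hyk'⟩ :=
    exists_vertical_edge hT p' (k := k) (by omega) (by omega)
  have : x = x' := Prod.ext ((h x y hxy hxk hyk).trans (h x' y' hxy' hxk' hyk').symm)
    (Fin.ext (hxk.trans hxk'.symm))
  exact hp' x' hx' (this ▸ hp x hx)

end Walks

/-! ### The switching map and the decay of double crossings -/

/-- A spanning tree can be modified on the rings `k` and `k + 1` so that a single edge joins
these rings. -/
theorem exists_switch {n m : ℕ} (T : SpanningTree (cylinder n m)) {k : ℕ} (hk : k + 1 < m)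
    (i : Fin n) :
    ∃ T' : SpanningTree (cylinder n m),
      (∀ x y, T.1.Adj x y → ((x.2 : ℕ) ≤ k ↔ (y.2 : ℕ) ≤ k) → T'.1.Adj x y) ∧
      (∀ x y, T'.1.Adj x y → ((x.2 : ℕ) = k ∨ (x.2 : ℕ) = k + 1) ∧
        ((y.2 : ℕ) = k ∨ (y.2 : ℕ) = k + 1) ∨ T.1.Adj x y) ∧
      ∀ x y, T'.1.Adj x y → (x.2 : ℕ) = k → (y.2 : ℕ) = k + 1 → x.1 = i := by
  obtain ⟨T, hTle, hT⟩ := T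
  -- `F` cuts `T` between rings `k` and `k + 1`; `B` consists of these two full rings and the one
  -- vertical edge over `i`. The new tree extends the forest `F` inside `F ⊔ B`.
  let F : SimpleGraph (Fin n × Fin m) :=
    { Adj := fun x y ↦ T.Adj x y ∧ ((x.2 : ℕ) ≤ k ↔ (y.2 : ℕ) ≤ k)
      symm := ⟨fun x y h ↦ ⟨h.1.symm, h.2.symm⟩⟩
      loopless := ⟨fun x h ↦ T.loopless.1 x h.1⟩ }
  let B : SimpleGraph (Fin n × Fin m) :=
    { Adj := fun x y ↦ (cylinder n m).Adj x y ∧ ((x.2 : ℕ) = k ∨ (x.2 : ℕ) = k + 1) ∧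
        ((y.2 : ℕ) = k ∨ (y.2 : ℕ) = k + 1) ∧ (x.2 = y.2 ∨ x.1 = i)
      symm := ⟨fun x y h ↦ ⟨h.1.symm, h.2.2.1, h.2.1, by
        rcases h.2.2.2 with h' | h'
        · exact .inl h'.symm
        · rcases cylinder_adj.1 h.1 with h'' | h''
          · exact .inl h''.2.symm
          · exact .inr (h''.2 ▸ h')⟩⟩
      loopless := ⟨fun x h ↦ (cylinder n m).loopless.1 x h.1⟩ }
  have hFT : F ≤ T := fun x y h ↦ h.1
  have hH : F ⊔ B ≤ cylinder n m := sup_le (hFT.trans hTle) fun x y h ↦ h.1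
  obtain ⟨n, rfl⟩ : ∃ n', n = n' + 1 := Nat.exists_eq_add_of_le' i.pos
  have hring : ∀ (j : Fin m), ((j : ℕ) = k ∨ (j : ℕ) = k + 1) → ∀ x y : Fin (n + 1),
      (F ⊔ B).Reachable (x, j) (y, j) := by
    intro j hj x y
    obtain ⟨p⟩ := (cycleGraph_connected (n := n)).preconnected x y
    induction p with
    | nil => rfl
    | @cons x y _ h p ih =>
      have hxy : (F ⊔ B).Adj (x, j) (y, j) :=
        .inr ⟨cylinder_adj.2 (.inl ⟨h, rfl⟩), hj, hj, .inl rfl⟩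
      exact hxy.reachable.trans ih
  have hblock : ∀ v : Fin (n + 1) × Fin m, ((v.2 : ℕ) = k ∨ (v.2 : ℕ) = k + 1) →
      (F ⊔ B).Reachable (i, ⟨k, by omega⟩) v := by
    intro v hv
    have hedge : (F ⊔ B).Reachable (i, ⟨k, by omega⟩) (i, ⟨k + 1, hk⟩) :=
      Adj.reachable (.inr ⟨cylinder_adj.2 (.inr ⟨.inl rfl, rfl⟩), .inl rfl, .inr rfl, .inr rfl⟩)
    have hv₁ := hring v.2 hv i v.1
    rcases hv with hv | hv
    · have : (⟨k, by omega⟩ : Fin m) = v.2 := Fin.ext hv.symm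
      rw [this]; exact hv₁
    · have : (⟨k + 1, hk⟩ : Fin m) = v.2 := Fin.ext hv.symm
      rw [this] at hedge
      exact hedge.trans hv₁
  have hreach : ∀ v, (F ⊔ B).Reachable (i, ⟨k, by omega⟩) v := by
    suffices h : ∀ u v (_ : T.Walk u v), (F ⊔ B).Reachable (i, ⟨k, by omega⟩) v →
        (F ⊔ B).Reachable (i, ⟨k, by omega⟩) u by
      intro v
      obtain ⟨p⟩ := hT.connected.preconnected v (i, ⟨k, by omega⟩)
      exact h _ _ p (.refl _)
    intro u v p hv
    induction p with
    | nil => exact hv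
    | @cons x y _ h p ih =>
      replace ih := ih hv
      by_cases hxy : (x.2 : ℕ) ≤ k ↔ (y.2 : ℕ) ≤ k
      · exact ih.trans (Adj.reachable (.inl ⟨h.symm, hxy.symm⟩))
      · have h₁ := cylinder_adj_snd_le (hTle h)
        have h₂ := cylinder_adj_snd_le (hTle h.symm)
        -- An edge of `T` missing from `F` joins rings `k` and `k + 1`, so its ends lie in the
        -- connected block `B`.
        exact hblock x (by omega)
  have hconn : (F ⊔ B).Connected :=
    { preconnected := fun u v ↦ (hreach u).symm.trans (hreach v)
      nonempty := ⟨(i, ⟨k, by omega⟩)⟩ }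
  obtain ⟨T', hFT', hT'H, hT'⟩ :=
    hconn.exists_isTree_le_of_le_of_isAcyclic le_sup_left (hT.isAcyclic.anti hFT)
  refine ⟨⟨T', hT'H.trans hH, hT'⟩, fun x y h h' ↦ hFT' ⟨h, h'⟩, fun x y h ↦ ?_, fun x y h hx hy ↦ ?_⟩
  · rcases hT'H h with h | h
    · exact .inr h.1
    · exact .inl ⟨h.2.1, h.2.2.1⟩
  · rcases hT'H h with h | h
    · have := h.2; omega
    · rcases h.2.2.2 with h | h
      · rw [h] at hx; omega
      · exact h

instance {V : Type*} [Finite V] (G : SimpleGraph V) : Finite (SpanningTree G) :=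
  Subtype.finite

/-- The spanning trees of the cylinder with two disjoint crossings between the `a`-th and the
`b`-th ring. -/
def doublyCrossed (n m a b : ℕ) : Set (SpanningTree (cylinder n m)) := {T | TwoCrossings T.1 a b}

/-- The number of binary relations on the vertices of two rings. -/
noncomputable def blockCount (n : ℕ) : ℕ := Nat.card (Set ((Fin n × Bool) × (Fin n × Bool)))

theorem blockCount_pos (n : ℕ) : 0 < blockCount n := Nat.card_pos

/-- A tree is recovered from its switched tree together with its own edges on the two rings, for
which there are at most `blockCount n` possibilities. -/
theorem ncard_doublyCrossed_le_diff {n m a k : ℕ} (hn : 1 ≤ n) (hak : a ≤ k) :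
    (doublyCrossed n m a (k + 1)).ncard ≤
      (doublyCrossed n m a k \ doublyCrossed n m a (k + 1)).ncard * blockCount n := by
  by_cases hk : k + 1 < m
  swap
  · have : doublyCrossed n m a (k + 1) = ∅ := by
      refine Set.eq_empty_of_forall_notMem ?_
      rintro T ⟨S, ⟨u, v, p, hu, hv, -⟩, -⟩
      omega
    simp [this]
  choose f hf₁ hf₂ hf₃ using fun T : SpanningTree (cylinder n m) ↦ exists_switch T hk ⟨0, hn⟩
  let r : Bool → Fin m := fun b ↦ if b then ⟨k + 1, hk⟩ else ⟨k, by omega⟩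
  let c : SpanningTree (cylinder n m) → Set ((Fin n × Bool) × (Fin n × Bool)) :=
    fun T ↦ {e | T.1.Adj (e.1.1, r e.1.2) (e.2.1, r e.2.2)}
  have hr : ∀ j : Fin m, ((j : ℕ) = k ∨ (j : ℕ) = k + 1) → ∃ b, r b = j := by
    rintro j (hj | hj)
    · exact ⟨false, Fin.ext hj.symm⟩
    · exact ⟨true, Fin.ext hj.symm⟩
  rw [blockCount, ← Set.ncard_univ, ← Set.ncard_prod]
  refine Set.ncard_le_ncard_of_injOn (fun T ↦ (f T, c T)) ?_ ?_
  · intro T hT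
    refine ⟨⟨?_, ?_⟩, Set.mem_univ _⟩
    · obtain ⟨S, h₁, h₂⟩ := TwoCrossings.mono_right T.2.1 hT hak k.le_succ
      have h : ∀ x y, T.1.Adj x y → (x.2 : ℕ) ≤ k → (y.2 : ℕ) ≤ k → (f T).1.Adj x y :=
        fun x y h hx hy ↦ hf₁ T x y h (iff_of_true hx hy)
      exact ⟨S, h₁.of_adj_below T.2.1 h hak, h₂.of_adj_below T.2.1 h hak⟩
    · exact not_twoCrossings_of_unique_edge (f T).2.1 hak _ (hf₃ T)
  · intro T _ T' _ h
    obtain ⟨hf, hc⟩ := Prod.ext_iff.1 h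
    replace hf : f T = f T' := hf
    replace hc : c T = c T' := hc
    have key : ∀ T₁ T₂ : SpanningTree (cylinder n m), f T₁ = f T₂ → c T₁ = c T₂ →
        T₁.1 ≤ T₂.1 := by
      intro T₁ T₂ hf hc x y hxy
      by_cases hb : ((x.2 : ℕ) = k ∨ (x.2 : ℕ) = k + 1) ∧ ((y.2 : ℕ) = k ∨ (y.2 : ℕ) = k + 1)
      · obtain ⟨b₁, hb₁⟩ := hr _ hb.1
        obtain ⟨b₂, hb₂⟩ := hr _ hb.2
        have : ((x.1, b₁), (y.1, b₂)) ∈ c T₁ := by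
          change T₁.1.Adj (x.1, r b₁) (y.1, r b₂)
          rwa [hb₁, hb₂]
        rw [hc] at this
        change T₂.1.Adj (x.1, r b₁) (y.1, r b₂) at this
        rwa [hb₁, hb₂] at this
      -- An edge outside the block does not cross the cut, so it survives the switch; outside the
      -- block the switch adds no edge.
      · have h₁ := cylinder_adj_snd_le (T₁.2.1 hxy)
        have h₂ := cylinder_adj_snd_le (T₁.2.1 hxy.symm)
        have := hf₁ T₁ x y hxy (by omega)
        rw [hf] at this
        exact (hf₂ T₂ x y this).resolve_left hb
    exact Subtype.ext (le_antisymm (key T T' hf hc) (key T' T hf.symm hc.symm))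

theorem ncard_doublyCrossed_succ_le {n m a k : ℕ} (hn : 1 ≤ n) (hak : a ≤ k) :
    (blockCount n + 1) * (doublyCrossed n m a (k + 1)).ncard ≤
      blockCount n * (doublyCrossed n m a k).ncard := by
  have hsub : doublyCrossed n m a (k + 1) ⊆ doublyCrossed n m a k :=
    fun T hT ↦ TwoCrossings.mono_right T.2.1 hT hak k.le_succ
  have h₁ := ncard_doublyCrossed_le_diff (m := m) hn hak
  have h₂ := Set.ncard_sdiff_add_ncard_of_subset hsub
  rw [← h₂]
  nlinarith

/-- The factor by which the number of doubly crossed trees drops from a ring to the next one. -/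
noncomputable def crossingRatio (n : ℕ) : ℝ := blockCount n / (blockCount n + 1)

theorem crossingRatio_pos (n : ℕ) : 0 < crossingRatio n := by
  have : (0 : ℝ) < blockCount n := by exact_mod_cast blockCount_pos n
  unfold crossingRatio; positivity

theorem crossingRatio_lt_one (n : ℕ) : crossingRatio n < 1 := by
  unfold crossingRatio
  rw [div_lt_one (by positivity)]
  linarith

theorem ncard_doublyCrossed_le {n : ℕ} (hn : 1 ≤ n) (m a w : ℕ) :
    ((doublyCrossed n m a (a + w)).ncard : ℝ) ≤
      crossingRatio n ^ w * Nat.card (SpanningTree (cylinder n m)) := by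
  induction w with
  | zero =>
    rw [pow_zero, one_mul, ← Set.ncard_univ]
    exact_mod_cast Set.ncard_le_ncard (Set.subset_univ _)
  | succ w ih =>
    have h : ((blockCount n : ℝ) + 1) * (doublyCrossed n m a (a + w + 1)).ncard ≤
        blockCount n * (doublyCrossed n m a (a + w)).ncard := by
      exact_mod_cast ncard_doublyCrossed_succ_le (m := m) hn (Nat.le_add_right a w)
    calc ((doublyCrossed n m a (a + (w + 1))).ncard : ℝ)
        ≤ crossingRatio n * (doublyCrossed n m a (a + w)).ncard := by
          rw [crossingRatio, div_mul_eq_mul_div, le_div_iff₀ (by positivity), mul_comm]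
          exact h
      _ ≤ crossingRatio n * (crossingRatio n ^ w * Nat.card (SpanningTree (cylinder n m))) :=
          mul_le_mul_of_nonneg_left ih (crossingRatio_pos n).le
      _ = _ := by ring

/-! ### Long branches and the final estimate -/

theorem exists_trunk {n m : ℕ} (hn : 1 ≤ n) (hm : 1 ≤ m) (T : SpanningTree (cylinder n m)) :
    Nonempty (Trunk T) := by
  classical
  obtain ⟨p, hp⟩ := T.2.2.connected.exists_isPath (⟨0, hn⟩, ⟨0, hm⟩) (⟨0, hn⟩, ⟨m - 1, by omega⟩)
  refine ⟨⟨_, _, p, hp, fun k ↦ ?_⟩⟩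
  obtain ⟨w, q, hw, hq⟩ := exists_walk_below T.2.1 p (k := k) (Nat.zero_le _)
    (by have := k.2; simp only; omega)
  exact ⟨w, (hq w q.end_mem_support).1, Fin.ext hw⟩

theorem not_hasBranch_of_one {m : ℕ} {T : SpanningTree (cylinder 1 m)} (L : Trunk T) (l : ℕ) :
    ¬ HasBranchOfLengthGE L l := by
  rintro ⟨u, v, p, ⟨hp, -⟩, -⟩
  obtain ⟨x, hx, hxv⟩ := L.meets_ring v.2
  have hxv' : x = v := Prod.ext (Subsingleton.elim _ _) hxv
  exact hp.ne ((hp.mem_iff v p.end_mem_support).1 (hxv' ▸ hx)).symm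

theorem HasBranchOfLengthGE.exists_twoCrossings {n m : ℕ} {T : SpanningTree (cylinder n m)}
    {L : Trunk T} {l : ℕ} (hn : 1 ≤ n) (h : HasBranchOfLengthGE L l) :
    ∃ a < m, TwoCrossings T.1 a (a + (l - 1) / n) := by
  classical
  obtain ⟨u, v, p, ⟨hp, -⟩, hl⟩ := h
  cases p with
  | nil => exact absurd rfl hp.ne
  | @cons _ x _ hux q =>
    obtain ⟨hq, huq⟩ := (Walk.cons_isPath_iff _ _).1 hp.isPath
    have hqL : ∀ y ∈ q.support, y ∈ L.verticesᶜ := fun y hy hyL ↦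
      huq ((hp.mem_iff y (by simp [hy])).1 hyL ▸ hy)
    have hne : q.support.toFinset.Nonempty := ⟨x, by simp⟩
    obtain ⟨s, hs, hsmin⟩ := Finset.exists_min_image q.support.toFinset (fun y ↦ y.2) hne
    obtain ⟨t, ht, htmax⟩ := Finset.exists_max_image q.support.toFinset (fun y ↦ y.2) hne
    have hst : s.2 ≤ t.2 := hsmin t ht
    -- The `l` distinct vertices of `q` lie in the rings from `s.2` to `t.2`, with `n` vertices
    -- each.
    have hcard : l ≤ n * (t.2 + 1 - s.2) := by
      calc l ≤ q.support.toFinset.card := by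
            rw [List.toFinset_card_of_nodup hq.support_nodup, Walk.length_support]
            simpa using hl
        _ ≤ (Finset.univ ×ˢ Finset.Icc s.2 t.2 : Finset (Fin n × Fin m)).card :=
            Finset.card_le_card fun y hy ↦ by
              simpa using And.intro (hsmin y hy) (htmax y hy)
        _ = _ := by simp [Fin.card_Icc]
    have hw : (s.2 : ℕ) + (l - 1) / n ≤ t.2 := by
      have hst' : (s.2 : ℕ) ≤ t.2 := hst
      have : (l - 1) / n < t.2 + 1 - s.2 := by
        rw [Nat.div_lt_iff_lt_mul hn, mul_comm]
        have : 0 < n * (t.2 + 1 - s.2 : ℕ) := Nat.mul_pos hn (by omega)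
        omega
      omega
    refine ⟨s.2, s.2.2, TwoCrossings.mono_right T.2.1 (c := t.2) ?_ (Nat.le_add_right _ _) hw⟩
    refine ⟨L.vertices, ?_, ?_⟩
    · obtain ⟨s', hs', hss'⟩ := L.meets_ring s.2
      obtain ⟨t', ht', htt'⟩ := L.meets_ring t.2
      obtain ⟨r, hr⟩ := exists_walk_between L.walk hs' ht'
      exact ⟨s', t', r, congrArg _ hss', congrArg _ htt', hr⟩
    · obtain ⟨r, hr⟩ := exists_walk_between q (List.mem_toFinset.1 hs) (List.mem_toFinset.1 ht)
      exact ⟨s, t, r, rfl, rfl, fun y hy ↦ hqL y (hr y hy)⟩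

theorem uniformSpanningTree_toOuterMeasure_toReal {V : Type*} [Finite V] (G : SimpleGraph V)
    (hG : G.Connected) (s : Set (SpanningTree G)) :
    ((uniformSpanningTree G hG).toOuterMeasure s).toReal =
      (s.ncard : ℝ) / Nat.card (SpanningTree G) := by
  classical
  have : Fintype s := Fintype.ofFinite s
  have : Nonempty (SpanningTree G) :=
    let ⟨T, hT⟩ := hG.exists_isTree_le
    ⟨⟨T, hT⟩⟩
  rw [uniformSpanningTree, PMF.toOuterMeasure_uniformOfFintype_apply, ENNReal.toReal_div,
    ENNReal.toReal_natCast, ENNReal.toReal_natCast, ← Nat.card_eq_fintype_card,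
    ← Nat.card_eq_fintype_card, Nat.card_coe_set_eq]

theorem ncard_hasBranch_le {n m : ℕ} (hn : 1 ≤ n)
    (L : (T : SpanningTree (cylinder n m)) → Trunk T) (l : ℕ) :
    ({T | HasBranchOfLengthGE (L T) l}.ncard : ℝ) ≤
      m * crossingRatio n ^ ((l - 1) / n) * Nat.card (SpanningTree (cylinder n m)) := by
  have hsub : {T | HasBranchOfLengthGE (L T) l} ⊆
      ⋃ a ∈ Finset.range m, doublyCrossed n m a (a + (l - 1) / n) := by
    intro T hT
    obtain ⟨a, ha, h⟩ := HasBranchOfLengthGE.exists_twoCrossings hn hT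
    exact Set.mem_biUnion (Finset.mem_coe.2 (Finset.mem_range.2 ha)) h
  calc ({T | HasBranchOfLengthGE (L T) l}.ncard : ℝ)
      ≤ ∑ a ∈ Finset.range m, ((doublyCrossed n m a (a + (l - 1) / n)).ncard : ℝ) := by
        exact_mod_cast (Set.ncard_le_ncard hsub).trans (Finset.set_ncard_biUnion_le _ _)
    _ ≤ ∑ _a ∈ Finset.range m,
          crossingRatio n ^ ((l - 1) / n) * Nat.card (SpanningTree (cylinder n m)) :=
        Finset.sum_le_sum fun a _ ↦ ncard_doublyCrossed_le hn m a _
    _ = _ := by simp [mul_assoc]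

theorem theorem1 (n : ℕ) (hn : 1 ≤ n) :
    ∃ C θ : ℝ, 0 < C ∧ 0 < θ ∧ θ < 1 ∧
      ∀ (m : ℕ) (hm : 1 ≤ m),
        ∃ L : (T : SpanningTree (cylinder n m)) → Trunk T,
          ∀ l : ℕ,
            ((uniformSpanningTree (cylinder n m) (cylinder_connected hn hm)).toOuterMeasure
              {T | HasBranchOfLengthGE (L T) l}).toReal ≤ C * m * ((n : ℝ) - 1) * θ ^ l := by
  have hq := crossingRatio_pos n
  have hq₁ := crossingRatio_lt_one n
  have hθ₀ : 0 < crossingRatio n ^ ((n : ℝ)⁻¹) := Real.rpow_pos_of_pos hq _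
  have hθ₁ : crossingRatio n ^ ((n : ℝ)⁻¹) < 1 := Real.rpow_lt_one hq.le hq₁ (by positivity)
  have hθn : (crossingRatio n ^ ((n : ℝ)⁻¹)) ^ n = crossingRatio n :=
    Real.rpow_inv_natCast_pow hq.le (by omega)
  generalize crossingRatio n ^ ((n : ℝ)⁻¹) = θ at hθ₀ hθ₁ hθn
  refine ⟨(crossingRatio n)⁻¹, θ, inv_pos.2 hq, hθ₀, hθ₁, fun m hm ↦
    ⟨fun T ↦ (exists_trunk hn hm T).some, fun l ↦ ?_⟩⟩
  rcases hn.eq_or_lt with rfl | hn₂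
  -- For `n = 1` the bound is 0, and the trunk covers every vertex. For `n ≥ 2` the factor `n - 1`
  -- is at least 1.
  · simp [not_hasBranch_of_one]
  have hN : (0 : ℝ) < Nat.card (SpanningTree (cylinder n m)) := by
    have : Nonempty (SpanningTree (cylinder n m)) :=
      let ⟨T, hT⟩ := (cylinder_connected hn hm).exists_isTree_le
      ⟨⟨T, hT⟩⟩
    exact_mod_cast Nat.card_pos
  have hn₁ : (1 : ℝ) ≤ (n : ℝ) - 1 := by
    have : (2 : ℝ) ≤ n := by exact_mod_cast hn₂
    linarith
  -- With `θ ^ n = crossingRatio n`, the constant `(crossingRatio n)⁻¹` absorbs the rounding in `(l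
  -- - 1) / n`.
  have hpow : crossingRatio n ^ ((l - 1) / n) ≤ (crossingRatio n)⁻¹ * θ ^ l := by
    have hl : l ≤ n * ((l - 1) / n + 1) := by
      have := Nat.lt_mul_div_succ (l - 1) hn
      omega
    rw [le_inv_mul_iff₀ hq, ← pow_succ']
    calc crossingRatio n ^ ((l - 1) / n + 1) = θ ^ (n * ((l - 1) / n + 1)) := by
          rw [pow_mul, hθn]
      _ ≤ θ ^ l := pow_le_pow_of_le_one hθ₀.le hθ₁.le hl
  rw [uniformSpanningTree_toOuterMeasure_toReal, div_le_iff₀ hN]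
  refine (ncard_hasBranch_le hn _ l).trans (mul_le_mul_of_nonneg_right ?_ hN.le)
  calc (m : ℝ) * crossingRatio n ^ ((l - 1) / n)
      ≤ m * ((crossingRatio n)⁻¹ * θ ^ l) := mul_le_mul_of_nonneg_left hpow (Nat.cast_nonneg m)
    _ = (crossingRatio n)⁻¹ * m * θ ^ l * 1 := by ring
    _ ≤ (crossingRatio n)⁻¹ * m * θ ^ l * ((n : ℝ) - 1) :=
        mul_le_mul_of_nonneg_left hn₁ (by positivity)
    _ = _ := by ring
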